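/- Let $r>0$, $c_T>0$ with $c_T\neq r$, $0<x^*<B$, $\lambda>0$, $\delta\ge 0$, and put $x^{**}=\frac{c_TB-rx^*}{r-c_T}$. Losses arrive at the event times $T_1<T_2<\cdots$ of a Poisson process with intensity $\lambda$. Let $Z_1,Z_2,\dots$ be i.i.d. random variables with values in $[0,1]$ and distribution function $G_Z$, independent of the Poisson process. For $x\ge x^*$ let $X$ be the capital process with $X_0=x$ that satisfies $$\frac{dX_t}{dt}=r\,[X_t-x^*]^+ + c_T\,[B-X_t]^+$$ between the event times and $X_{T_i}=Z_i\,X_{T_i-}$ at the event times. Let $\tau_x=\inf\{t\ge0: X_t<x^*\}$ (with $\inf\emptyset=\infty$) be the trapping time, let $w\ge 0$ be a measurable penalty function, and let $$m_\delta(x)=\mathbb E\!\left[w\big(X_{\tau_x-}-x^*,\,|X_{\tau_x}-x^*|\big)e^{-\delta\tau_x}\mathbf 1_{\{\tau_x<\infty\}}\right]\in[0,\infty],\qquad x\ge x^*.$$ Write $m_{\delta,u}(x)=m_\delta(x)$ for $x\ge B$ and $m_{\delta,l}(x)=m_\delta(x)$ for $x^*\le x<B$, and let $$A(u)=\int_{[0,\,x^*/u)}w(u-x^*,\,x^*-uz)\,dG_Z(z).$$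 Then the following identities hold in $[0,\infty]$. (i) For $x\ge B$, $$m_{\delta,u}(x)=\frac{\lambda}{r}(x-x^*)^{\frac{\lambda+\delta}{r}}\int_x^\infty\frac{1}{(u-x^*)^{\frac{\lambda+\delta}{r}+1}}\left[\int_{[B/u,\,1]}m_{\delta,u}(uz)\,dG_Z(z)+\int_{[x^*/u,\,B/u)}m_{\delta,l}(uz)\,dG_Z(z)+A(u)\right]du.$$ (ii) For $x^*\le x<B$, $$\begin{aligned}m_{\delta,l}(x)={}&\frac{\lambda}{|r-c_T|}\,|x+x^{**}|^{\frac{\lambda+\delta}{r-c_T}}\int_x^B\frac{1}{|u+x^{**}|^{\frac{\lambda+\delta}{r-c_T}+1}}\left[\int_{[x^*/u,\,1]}m_{\delta,l}(uz)\,dG_Z(z)+A(u)\right]du\\&+\frac{\lambda}{r}(B-x^*)^{\frac{\lambda+\delta}{r}}\left(\frac{x+x^{**}}{B+x^{**}}\right)^{\frac{\lambda+\delta}{r-c_T}}\int_B^\infty\frac{1}{(v-x^*)^{\frac{\lambda+\delta}{r}+1}}\left[\int_{[B/v,\,1]}m_{\delta,u}(vz)\,dG_Z(z)+\int_{[x^*/v,\,B/v)}m_{\delta,l}(vz)\,dG_Z(z)+A(v)\right]dv.\end{aligned}$$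 For $c_T<r$ all quantities inside absolute values are positive, so the absolute values can be dropped. -/

import Mathlib

open MeasureTheory ProbabilityTheory Set Filter Topology
open scoped ENNReal NNReal

namespace CapitalModel

noncomputable section

/-- The growth rate of capital between losses: `r [y - x*]⁺ + c_T [B - y]⁺`. -/
def drift (r cT xs B y : ℝ) : ℝ := r * max (y - xs) 0 + cT * max (B - y) 0

/-- The time of the `n`-th loss, for waiting times `e 0, e 1, …`
(so `lossTime e 0 = 0` is the initial time and the first loss is at `lossTime e 1 = e 0`). -/
def lossTime (e : ℕ → ℝ) (n : ℕ) : ℝ := ∑ i ∈ Finset.range n, e i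

/-- `f` is a trajectory (on times `t ≥ 0`) of the capital process with initial capital `x`, waiting
times `e` between losses and remaining proportions `z`: it solves `f' = drift f` from each
loss (or from time `0`) up to the next one, and at the `(n+1)`-st loss the capital just before the
loss is multiplied by `z n`. -/
structure IsCapitalPath (r cT xs B x : ℝ) (e z : ℕ → ℝ) (f : ℝ → ℝ) : Prop where
  initial : f 0 = x
  growth : ∀ n, ∀ t ∈ Ico (lossTime e n) (lossTime e (n + 1)),
    HasDerivWithinAt f (drift r cT xs B (f t)) (Ico (lossTime e n) (lossTime e (n + 1))) t
  left_limit : ∀ n, Tendsto f (𝓝[<] lossTime e (n + 1))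
    (𝓝 (Function.leftLim f (lossTime e (n + 1))))
  loss : ∀ n, f (lossTime e (n + 1)) = z n * Function.leftLim f (lossTime e (n + 1))

/-- The random input of the model: losses arrive according to a Poisson process with intensity
`lam` (the waiting times `E n` are i.i.d. exponential with rate `lam`), the remaining proportions
`Z n` are i.i.d. with values in `[0, 1]` and common law `G`, and the sequence of proportions is
independent of the Poisson process. -/
structure IsLossModel {Ω : Type*} [MeasurableSpace Ω] (P : Measure Ω) (lam : ℝ) (G : Measure ℝ)
    (E Z : ℕ → Ω → ℝ) : Prop where
  measurable_wait : ∀ n, Measurable (E n)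
  measurable_prop : ∀ n, Measurable (Z n)
  law_wait : ∀ n, P.map (E n) = expMeasure lam
  law_prop : ∀ n, P.map (Z n) = G
  prop_mem : ∀ᵐ z ∂G, z ∈ Icc (0 : ℝ) 1
  indep_wait : iIndepFun E P
  indep_prop : iIndepFun Z P
  indep : IndepFun (fun ω n => E n ω) (fun ω n => Z n ω) P

/-- `X x` is, for every initial capital `x ≥ x*`, the capital process started at `x`: almost surely
its trajectory is the one driven by the waiting times `E` and the proportions `Z`. -/
def IsCapitalProcess {Ω : Type*} [MeasurableSpace Ω] (P : Measure Ω) (r cT xs B : ℝ)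
    (E Z : ℕ → Ω → ℝ) (X : ℝ → ℝ → Ω → ℝ) : Prop :=
  ∀ x, xs ≤ x → ∀ᵐ ω ∂P,
    IsCapitalPath r cT xs B x (fun n => E n ω) (fun n => Z n ω) (fun t => X x t ω)

/-- The trapping time `inf {t ≥ 0 : f t < x*}` of a trajectory; it is `∞` if there is no such `t`. -/
def trappingTime (xs : ℝ) (f : ℝ → ℝ) : ℝ≥0∞ :=
  sInf (ENNReal.ofReal '' {t : ℝ | 0 ≤ t ∧ f t < xs})

open scoped Classical in
/-- The discounted penalty `w(f(τ-) - x*, |f(τ) - x*|) e^{-δ τ} 1{τ < ∞}` of a trajectory. -/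
def discountedPenalty (xs δ : ℝ) (w : ℝ → ℝ → ℝ≥0) (f : ℝ → ℝ) : ℝ≥0∞ :=
  if trappingTime xs f < ⊤ then
    (w (Function.leftLim f (trappingTime xs f).toReal - xs)
        |f (trappingTime xs f).toReal - xs| : ℝ≥0∞) *
      ENNReal.ofReal (Real.exp (-δ * (trappingTime xs f).toReal))
  else 0

/-- The expected discounted penalty function at the trapping time, as a function of the initial
capital `x`, for the family of processes `X`. The penalty is non-negative, so the expectation is
taken in `[0, ∞]`. -/
def expectedPenalty {Ω : Type*} [MeasurableSpace Ω] (P : Measure Ω) (xs δ : ℝ)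
    (w : ℝ → ℝ → ℝ≥0) (X : ℝ → ℝ → Ω → ℝ) (x : ℝ) : ℝ≥0∞ :=
  ∫⁻ ω, discountedPenalty xs δ w (fun t => X x t ω) ∂P

/-- `A(u)`: the contribution of a loss that hits at capital level `u` and traps. -/
def trapPenalty (xs : ℝ) (w : ℝ → ℝ → ℝ≥0) (G : Measure ℝ) (u : ℝ) : ℝ≥0∞ :=
  ∫⁻ z in Ico 0 (xs / u), (w (u - xs) (xs - u * z) : ℝ≥0∞) ∂G

/-- The constant `x** = (c_T B - r x*) / (r - c_T)`. -/
def xss (r cT xs B : ℝ) : ℝ := (cT * B - r * xs) / (r - cT)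

end

end CapitalModel

open CapitalModel

/-! Between losses the capital follows a deterministic flow, and after the first loss it restarts
with fresh independent copies of the inputs. Conditioning on the first loss gives `M x = ∫ λ
e^{-(λ+δ)t} L (φ_x t) dt`, where `φ_x` is the flow from `x` and `L u` is the mean value just after a
loss at level `u` (`meanPenalty_eq_setLIntegral`). Both identities are this equation after the
substitution `u = φ_x t`. The flow is exponential about `x*` above `B` and about `-x**` below `B`,
so the exponential density becomes a power of the distance to that point (`lintegral_flow_of_le`,
`lintegral_flow_of_lt`). The integral defining `L` is then cut where the remaining capital crosses
`x*` and `B`.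

To make the restart rigorous, the path functional is identified almost surely with `inputPenalty`,
an explicit measurable function of the initial capital and the two input sequences
(`IsCapitalPath.discountedPenalty_eq_inputPenalty`). The restart then becomes a recursion for that
function together with the splitting of an i.i.d. product measure. All integrands take values in
`[0, ∞]`, so Tonelli applies without integrability conditions. -/

namespace CapitalModel

/-! ### The deterministic growth between losses -/

section Flow

/-- The deterministic growth below `B`, which solves `y' = (r - cT) (y + x**)`. -/
noncomputable def lowerFlow (r cT xs B x t : ℝ) : ℝ :=
  (x + xss r cT xs B) * Real.exp ((r - cT) * t) - xss r cT xs B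

/-- The deterministic growth above `B`, which solves `y' = r (y - x*)`. -/
noncomputable def upperFlow (r xs x t : ℝ) : ℝ := xs + (x - xs) * Real.exp (r * t)

/-- The time at which the deterministic growth started at `x < B` reaches the level `B`. -/
noncomputable def hittingTime (r cT xs B x : ℝ) : ℝ :=
  Real.log ((B + xss r cT xs B) / (x + xss r cT xs B)) / (r - cT)

/-- The deterministic growth of capital between losses. -/
noncomputable def flow (r cT xs B x t : ℝ) : ℝ :=
  if B ≤ x then upperFlow r xs x t
  else if t < hittingTime r cT xs B x then lowerFlow r cT xs B x t
  else upperFlow r xs B (t - hittingTime r cT xs B x)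

variable {r cT xs B x t : ℝ}

lemma sub_mul_add_xss (hrc : r ≠ cT) (y : ℝ) :
    (r - cT) * (y + xss r cT xs B) = r * (y - xs) + cT * (B - y) := by
  have : r - cT ≠ 0 := sub_ne_zero.2 hrc
  unfold xss
  field_simp
  ring

/-- The product is the drift at `x`, hence positive for either sign of `r - cT`. So `x + x**` keeps
the sign of `r - cT` on `[x*, B]`: it may be negative, but quotients of two such terms are positive.
-/
lemma sub_mul_add_xss_pos (hr : 0 < r) (hcT : 0 < cT) (hrc : r ≠ cT) (hB : xs < B)
    (hx : xs ≤ x) (hxB : x ≤ B) : 0 < (r - cT) * (x + xss r cT xs B) := by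
  rw [sub_mul_add_xss hrc]
  rcases hx.eq_or_lt with rfl | h
  · simpa using mul_pos hcT (sub_pos.2 hB)
  · have h1 := mul_pos hr (sub_pos.2 h)
    have h2 := mul_nonneg hcT.le (sub_nonneg.2 hxB)
    linarith

lemma add_xss_ne_zero (hr : 0 < r) (hcT : 0 < cT) (hrc : r ≠ cT) (hB : xs < B)
    (hx : xs ≤ x) (hxB : x ≤ B) : x + xss r cT xs B ≠ 0 := by
  intro h
  have := sub_mul_add_xss_pos hr hcT hrc hB hx hxB
  simp [h] at this

lemma add_xss_div_pos (hr : 0 < r) (hcT : 0 < cT) (hrc : r ≠ cT) (hB : xs < B) {y : ℝ}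
    (hx : xs ≤ x) (hxB : x ≤ B) (hy : xs ≤ y) (hyB : y ≤ B) :
    0 < (y + xss r cT xs B) / (x + xss r cT xs B) := by
  have h1 := sub_mul_add_xss_pos hr hcT hrc hB hx hxB
  have h2 := sub_mul_add_xss_pos hr hcT hrc hB hy hyB
  have h3 : (y + xss r cT xs B) / (x + xss r cT xs B) =
      ((r - cT) * (y + xss r cT xs B)) / ((r - cT) * (x + xss r cT xs B)) :=
    (mul_div_mul_left _ _ (sub_ne_zero.2 hrc)).symm
  rw [h3]
  exact div_pos h2 h1

lemma exp_mul_hittingTime (hr : 0 < r) (hcT : 0 < cT) (hrc : r ≠ cT) (hB : xs < B)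
    (hx : xs ≤ x) (hxB : x ≤ B) : Real.exp ((r - cT) * hittingTime r cT xs B x) =
      (B + xss r cT xs B) / (x + xss r cT xs B) := by
  rw [hittingTime, mul_div_cancel₀ _ (sub_ne_zero.2 hrc),
    Real.exp_log (add_xss_div_pos hr hcT hrc hB hx hxB hB.le le_rfl)]

@[simp] lemma lowerFlow_zero : lowerFlow r cT xs B x 0 = x := by simp [lowerFlow]

@[simp] lemma upperFlow_zero : upperFlow r xs x 0 = x := by simp [upperFlow]

lemma lowerFlow_hittingTime (hr : 0 < r) (hcT : 0 < cT) (hrc : r ≠ cT) (hB : xs < B)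
    (hx : xs ≤ x) (hxB : x ≤ B) :
    lowerFlow r cT xs B x (hittingTime r cT xs B x) = B := by
  have := add_xss_ne_zero hr hcT hrc hB hx hxB
  rw [lowerFlow, exp_mul_hittingTime hr hcT hrc hB hx hxB, mul_div_cancel₀ _ this]
  ring

lemma hasDerivAt_lowerFlow (t : ℝ) : HasDerivAt (lowerFlow r cT xs B x)
    ((r - cT) * (x + xss r cT xs B) * Real.exp ((r - cT) * t)) t := by
  have h := ((((hasDerivAt_id t).const_mul (r - cT)).exp).const_mul
    (x + xss r cT xs B)).sub_const (xss r cT xs B)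
  refine h.congr_deriv ?_
  simp only [id, mul_one]
  ring

lemma hasDerivAt_upperFlow (t : ℝ) : HasDerivAt (upperFlow r xs x)
    (r * (x - xs) * Real.exp (r * t)) t := by
  have h := (((hasDerivAt_id t).const_mul r).exp.const_mul (x - xs)).const_add xs
  refine h.congr_deriv ?_
  simp only [id, mul_one]
  ring

lemma strictMono_lowerFlow (hr : 0 < r) (hcT : 0 < cT) (hrc : r ≠ cT) (hB : xs < B)
    (hx : xs ≤ x) (hxB : x ≤ B) : StrictMono (lowerFlow r cT xs B x) := by
  refine strictMono_of_hasDerivAt_pos (fun t => hasDerivAt_lowerFlow t) fun t => ?_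
  exact mul_pos (sub_mul_add_xss_pos hr hcT hrc hB hx hxB) (Real.exp_pos _)

lemma strictMono_upperFlow (hr : 0 < r) (hx : xs < x) : StrictMono (upperFlow r xs x) := by
  refine strictMono_of_hasDerivAt_pos (fun t => hasDerivAt_upperFlow t) fun t => ?_
  exact mul_pos (mul_pos hr (sub_pos.2 hx)) (Real.exp_pos _)

lemma hittingTime_pos (hr : 0 < r) (hcT : 0 < cT) (hrc : r ≠ cT) (hB : xs < B)
    (hx : xs ≤ x) (hxB : x < B) : 0 < hittingTime r cT xs B x := by
  rw [← (strictMono_lowerFlow hr hcT hrc hB hx hxB.le).lt_iff_lt, lowerFlow_zero,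
    lowerFlow_hittingTime hr hcT hrc hB hx hxB.le]
  exact hxB

lemma le_upperFlow (hr : 0 < r) (hx : xs < x) (ht : 0 ≤ t) : x ≤ upperFlow r xs x t := by
  simpa using (strictMono_upperFlow hr hx).monotone ht

lemma flow_zero (hr : 0 < r) (hcT : 0 < cT) (hrc : r ≠ cT) (hB : xs < B) (hx : xs ≤ x) :
    flow r cT xs B x 0 = x := by
  unfold flow
  split_ifs with h1 h2
  · simp
  · simp
  · exact absurd (hittingTime_pos hr hcT hrc hB hx (not_le.1 h1)) h2

lemma le_flow (hr : 0 < r) (hcT : 0 < cT) (hrc : r ≠ cT) (hB : xs < B) (hx : xs ≤ x)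
    (ht : 0 ≤ t) : xs ≤ flow r cT xs B x t := by
  unfold flow
  split_ifs with h1 h2
  · exact hx.trans (le_upperFlow hr (hB.trans_le h1) ht)
  · refine hx.trans ?_
    simpa using (strictMono_lowerFlow hr hcT hrc hB hx (not_le.1 h1).le).monotone ht
  · exact hB.le.trans (le_upperFlow hr hB (by linarith))

lemma drift_upperFlow (hr : 0 < r) (hB : xs < B) (hx : B ≤ x) (ht : 0 ≤ t) :
    drift r cT xs B (upperFlow r xs x t) = r * (x - xs) * Real.exp (r * t) := by
  have h := le_upperFlow hr (hB.trans_le hx) ht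
  rw [drift, max_eq_left (by linarith), max_eq_right (by linarith), upperFlow]
  ring

/-- A right derivative is all that ODE uniqueness asks for, so at the hitting time of `B` only the
upper branch has to be examined. -/
lemma hasDerivWithinAt_flow (hr : 0 < r) (hcT : 0 < cT) (hrc : r ≠ cT) (hB : xs < B)
    (hx : xs ≤ x) (ht : 0 ≤ t) :
    HasDerivWithinAt (flow r cT xs B x) (drift r cT xs B (flow r cT xs B x t)) (Ici t) t := by
  rcases le_or_gt B x with h1 | h1
  · have : flow r cT xs B x = upperFlow r xs x := by
      funext s; simp [flow, h1]
    rw [this, drift_upperFlow hr hB h1 ht]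
    exact (hasDerivAt_upperFlow t).hasDerivWithinAt
  · rcases lt_or_ge t (hittingTime r cT xs B x) with h2 | h2
    · have e : flow r cT xs B x =ᶠ[𝓝 t] lowerFlow r cT xs B x := by
        filter_upwards [Iio_mem_nhds h2] with s hs
        simp [flow, not_le.2 h1, mem_Iio.1 hs]
      rw [e.self_of_nhds]
      have m := strictMono_lowerFlow hr hcT hrc hB hx h1.le
      have h3 : x ≤ lowerFlow r cT xs B x t := by simpa using m.monotone ht
      have h4 : lowerFlow r cT xs B x t < B := by
        have := m h2
        rwa [lowerFlow_hittingTime hr hcT hrc hB hx h1.le] at this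
      refine (((hasDerivAt_lowerFlow t).congr_of_eventuallyEq e).congr_deriv ?_).hasDerivWithinAt
      rw [drift, max_eq_left (by linarith), max_eq_left (by linarith), ← sub_mul_add_xss hrc,
        lowerFlow]
      ring
    · have e : ∀ s ∈ Ici t, flow r cT xs B x s =
          upperFlow r xs B (s - hittingTime r cT xs B x) := fun s hs => by
        simp [flow, not_le.2 h1, not_lt.2 (h2.trans (mem_Ici.1 hs))]
      rw [e t self_mem_Ici, drift_upperFlow hr hB le_rfl (by linarith)]
      refine HasDerivWithinAt.congr ?_ e (e t self_mem_Ici)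
      exact ((hasDerivAt_upperFlow (t - hittingTime r cT xs B x)).comp_sub_const t
        (hittingTime r cT xs B x)).hasDerivWithinAt

lemma continuous_lowerFlow : Continuous (lowerFlow r cT xs B x) := by
  unfold lowerFlow; fun_prop

lemma continuous_upperFlow : Continuous (upperFlow r xs x) := by
  unfold upperFlow; fun_prop

lemma continuous_flow (hr : 0 < r) (hcT : 0 < cT) (hrc : r ≠ cT) (hB : xs < B)
    (hx : xs ≤ x) : Continuous (flow r cT xs B x) := by
  rcases le_or_gt B x with h1 | h1
  · have : flow r cT xs B x = upperFlow r xs x := by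
      funext s; simp [flow, h1]
    rw [this]
    exact continuous_upperFlow
  · have : flow r cT xs B x = fun t => if hittingTime r cT xs B x ≤ t then
        upperFlow r xs B (t - hittingTime r cT xs B x) else lowerFlow r cT xs B x t := by
      funext s
      by_cases h : hittingTime r cT xs B x ≤ s <;> simp [flow, h1, h, not_lt.2, lt_of_not_ge]
    rw [this]
    refine Continuous.if_le (continuous_upperFlow.comp (continuous_id.sub continuous_const))
      continuous_lowerFlow continuous_const continuous_id ?_
    rintro s rfl
    simp [lowerFlow_hittingTime hr hcT hrc hB hx h1.le]

lemma measurable_flow : Measurable (fun p : ℝ × ℝ => flow r cT xs B p.1 p.2) := by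
  have h : Measurable (fun p : ℝ × ℝ => hittingTime r cT xs B p.1) := by
    unfold hittingTime; fun_prop
  unfold flow upperFlow lowerFlow
  refine Measurable.ite (measurableSet_le measurable_const measurable_fst) (by fun_prop) ?_
  exact Measurable.ite (measurableSet_lt measurable_snd h) (by fun_prop) (by fun_prop)

lemma lipschitzWith_drift : ∃ K, LipschitzWith K (drift r cT xs B) := by
  have h1 : LipschitzWith 1 (fun y : ℝ => max (y - xs) 0) :=
    (LipschitzWith.id.sub (LipschitzWith.const xs)).max_const 0 |>.weaken (by simp)
  have h2 : LipschitzWith 1 (fun y : ℝ => max (B - y) 0) :=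
    ((LipschitzWith.const B).sub LipschitzWith.id).max_const 0 |>.weaken (by simp)
  have h3 := ((lipschitzWith_smul r).comp h1).add ((lipschitzWith_smul cT).comp h2)
  exact ⟨_, h3⟩

/-- A solution of the growth equation from `x ≥ x*` is the explicit flow. -/
lemma eq_flow_of_hasDerivWithinAt (hr : 0 < r) (hcT : 0 < cT) (hrc : r ≠ cT) (hB : xs < B)
    (hx : xs ≤ x) {f : ℝ → ℝ} {T : ℝ} (h0 : f 0 = x)
    (hf : ∀ t ∈ Ico 0 T, HasDerivWithinAt f (drift r cT xs B (f t)) (Ico 0 T) t)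
    (ht : t ∈ Ico 0 T) : f t = flow r cT xs B x t := by
  obtain ⟨K, hK⟩ := lipschitzWith_drift (r := r) (cT := cT) (xs := xs) (B := B)
  have hsub : Icc 0 t ⊆ Ico 0 T := fun s hs => ⟨hs.1, hs.2.trans_lt ht.2⟩
  refine ODE_solution_unique_of_mem_Icc_right (v := fun _ => drift r cT xs B)
    (s := fun _ => univ) (a := 0) (b := t) (K := K) (fun s _ => hK.lipschitzOnWith) ?_ ?_
    (fun _ _ => mem_univ _) (continuous_flow hr hcT hrc hB hx).continuousOn ?_
    (fun _ _ => mem_univ _) (by rw [h0, flow_zero hr hcT hrc hB hx]) (right_mem_Icc.2 ht.1)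
  · exact fun s hs => (hf s (hsub hs)).continuousWithinAt.mono hsub
  · intro s hs
    have hs' : s ∈ Ico 0 T := hsub (Ico_subset_Icc_self hs)
    refine (hf s hs').mono_of_mem_nhdsWithin ?_
    refine mem_of_superset (Ico_mem_nhdsGE hs'.2) (Ico_subset_Ico_left hs'.1)
  · exact fun s hs => hasDerivWithinAt_flow hr hcT hrc hB hx hs.1

end Flow

/-! ### Trajectories, their restart after a loss, and the penalty as a function of the inputs -/

section Paths

lemma leftLim_comp_add (f : ℝ → ℝ) (c a : ℝ) :
    Function.leftLim (fun t => f (t + c)) a = Function.leftLim f (a + c) := by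
  have hmap : Filter.map (fun t => t + c) (𝓝[<] a) = 𝓝[<] (a + c) := by
    simp
  have key : ∀ y, Tendsto (fun t => f (t + c)) (𝓝[<] a) (𝓝 y) ↔
      Tendsto f (𝓝[<] (a + c)) (𝓝 y) := fun y => by
    rw [← hmap, tendsto_map'_iff]; rfl
  by_cases h : ∃ y, Tendsto f (𝓝[<] (a + c)) (𝓝 y)
  · obtain ⟨y, hy⟩ := h
    rw [leftLim_eq_of_tendsto hy, leftLim_eq_of_tendsto ((key y).2 hy)]
  -- Without a limit, `leftLim` defaults to the value at the point, and this default also commutes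
  -- with translation.
  · rw [leftLim_eq_of_not_tendsto f h, leftLim_eq_of_not_tendsto]
    rintro ⟨y, hy⟩
    exact h ⟨y, (key y).1 hy⟩

@[simp] lemma lossTime_zero (e : ℕ → ℝ) : lossTime e 0 = 0 := by simp [lossTime]

lemma lossTime_succ' (e : ℕ → ℝ) (n : ℕ) :
    lossTime e (n + 1) = lossTime (fun i => e (i + 1)) n + e 0 := by
  simp [lossTime, Finset.sum_range_succ']

@[simp] lemma lossTime_one (e : ℕ → ℝ) : lossTime e 1 = e 0 := by simp [lossTime]

variable {r cT xs B x δ : ℝ} {e z : ℕ → ℝ} {f : ℝ → ℝ} {w : ℝ → ℝ → ℝ≥0}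

lemma IsCapitalPath.eq_flow (hf : IsCapitalPath r cT xs B x e z f) (hr : 0 < r) (hcT : 0 < cT)
    (hrc : r ≠ cT) (hB : xs < B) (hx : xs ≤ x) {t : ℝ} (ht : t ∈ Ico 0 (e 0)) :
    f t = flow r cT xs B x t := by
  have h := hf.growth 0
  simp only [lossTime_zero, zero_add, lossTime_one] at h
  exact eq_flow_of_hasDerivWithinAt hr hcT hrc hB hx hf.initial h ht

lemma IsCapitalPath.leftLim_eq (hf : IsCapitalPath r cT xs B x e z f) (hr : 0 < r) (hcT : 0 < cT)
    (hrc : r ≠ cT) (hB : xs < B) (hx : xs ≤ x) (he : 0 < e 0) :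
    Function.leftLim f (e 0) = flow r cT xs B x (e 0) := by
  refine leftLim_eq_of_tendsto ?_
  refine Tendsto.congr' ?_ ((continuous_flow hr hcT hrc hB hx).continuousWithinAt (s := Iio (e 0)))
  filter_upwards [Ico_mem_nhdsLT he] with t ht
  exact (hf.eq_flow hr hcT hrc hB hx ht).symm

lemma IsCapitalPath.apply_wait (hf : IsCapitalPath r cT xs B x e z f) (hr : 0 < r) (hcT : 0 < cT)
    (hrc : r ≠ cT) (hB : xs < B) (hx : xs ≤ x) (he : 0 < e 0) :
    f (e 0) = z 0 * flow r cT xs B x (e 0) := by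
  have h := hf.loss 0
  simp only [zero_add, lossTime_one] at h
  rw [h, hf.leftLim_eq hr hcT hrc hB hx he]

/-- After the first loss the trajectory is again a trajectory, for the shifted inputs. -/
lemma IsCapitalPath.shift (hf : IsCapitalPath r cT xs B x e z f) :
    IsCapitalPath r cT xs B (f (e 0)) (fun i => e (i + 1)) (fun i => z (i + 1))
      (fun t => f (t + e 0)) where
  initial := by simp
  growth n t ht := by
    have h := hf.growth (n + 1) (t + e 0)
    rw [lossTime_succ', lossTime_succ' e (n + 1)] at h
    have h1 := h ⟨by linarith [ht.1], by linarith [ht.2]⟩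
    have hd : HasDerivWithinAt (fun s => s + e 0) 1
        (Ico (lossTime (fun i => e (i + 1)) n) (lossTime (fun i => e (i + 1)) (n + 1))) t :=
      ((hasDerivAt_id t).add_const (e 0)).hasDerivWithinAt
    have h2 := h1.scomp t hd fun s hs => by
      constructor <;> linarith [hs.1, hs.2]
    simpa [Function.comp_def] using h2
  left_limit n := by
    have h := hf.left_limit (n + 1)
    rw [lossTime_succ' e (n + 1)] at h
    rw [leftLim_comp_add]
    refine h.comp (tendsto_nhdsWithin_iff.2 ⟨?_, ?_⟩)
    · exact ((continuous_id.add continuous_const).tendsto _).mono_left nhdsWithin_le_nhds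
    · filter_upwards [self_mem_nhdsWithin] with s hs
      simpa using hs
  loss n := by
    have h := hf.loss (n + 1)
    rw [lossTime_succ' e (n + 1)] at h
    rw [leftLim_comp_add]
    exact h

/-- Nothing is trapped before `c`, so the trapped times are those of the shifted path translated by
`c`. In `[0, ∞]` the identity also covers paths that are never trapped. -/
lemma trappingTime_shift {c : ℝ} (hc : 0 ≤ c) (hf : ∀ t ∈ Ico 0 c, xs ≤ f t) :
    trappingTime xs f = trappingTime xs (fun t => f (t + c)) + ENNReal.ofReal c := by
  have hset : {t : ℝ | 0 ≤ t ∧ f t < xs} =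
      (fun t => t + c) '' {t : ℝ | 0 ≤ t ∧ f (t + c) < xs} := by
    ext t
    simp only [mem_ofPred_eq, mem_image]
    constructor
    · rintro ⟨h0, h1⟩
      have : c ≤ t := by
        by_contra h
        exact absurd (hf t ⟨h0, not_le.1 h⟩) (not_le.2 h1)
      exact ⟨t - c, ⟨by linarith, by simpa using h1⟩, by ring⟩
    · rintro ⟨s, ⟨h0, h1⟩, rfl⟩
      exact ⟨by linarith, h1⟩
  unfold trappingTime
  rw [hset, image_image, sInf_image, sInf_image, ENNReal.iInf_add]
  refine iInf_congr fun s => ?_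
  by_cases hs : s ∈ {t : ℝ | 0 ≤ t ∧ f (t + c) < xs}
  · simp only [hs, iInf_pos, ENNReal.ofReal_add hs.1 hc]
  · simp [hs]

lemma trappingTime_eq_zero (h : f 0 < xs) : trappingTime xs f = 0 := by
  refine le_antisymm (sInf_le ⟨0, ⟨le_rfl, h⟩, by simp⟩) bot_le

/-- The discounted penalty splits at a time before which there is no trapping. -/
lemma discountedPenalty_shift {c : ℝ} (hc : 0 ≤ c) (hf : ∀ t ∈ Ico 0 c, xs ≤ f t) :
    discountedPenalty xs δ w f = ENNReal.ofReal (Real.exp (-δ * c)) *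
      discountedPenalty xs δ w (fun t => f (t + c)) := by
  unfold discountedPenalty
  rw [trappingTime_shift hc hf]
  by_cases h : trappingTime xs (fun t => f (t + c)) < ⊤
  · have h' : trappingTime xs (fun t => f (t + c)) + ENNReal.ofReal c < ⊤ :=
      ENNReal.add_lt_top.2 ⟨h, ENNReal.ofReal_lt_top⟩
    rw [if_pos h, if_pos h', ENNReal.toReal_add h.ne ENNReal.ofReal_ne_top,
      ENNReal.toReal_ofReal hc, leftLim_comp_add, mul_add, Real.exp_add,
      ENNReal.ofReal_mul (Real.exp_pos _).le]
    ring
  · have h' : ¬ trappingTime xs (fun t => f (t + c)) + ENNReal.ofReal c < ⊤ := fun h' =>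
      h (lt_of_le_of_lt le_self_add h')
    rw [if_neg h, if_neg h', mul_zero]

/-- Meant for a path shifted to a loss that traps: the left limit at `0` then looks at negative
times and gives the capital just before the loss. -/
lemma discountedPenalty_of_lt (h : f 0 < xs) :
    discountedPenalty xs δ w f = w (Function.leftLim f 0 - xs) (xs - f 0) := by
  unfold discountedPenalty
  rw [trappingTime_eq_zero h, if_pos ENNReal.zero_lt_top]
  simp [abs_of_neg (sub_neg.2 h)]

/-- The discounted penalty of the trajectory driven by `e` and `z`, if trapping happens within
the first `n` losses (and `0` otherwise). -/
noncomputable def truncatedPenalty (r cT xs B δ : ℝ) (w : ℝ → ℝ → ℝ≥0) :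
    ℕ → ℝ → (ℕ → ℝ) → (ℕ → ℝ) → ℝ≥0∞
  | 0, _, _, _ => 0
  | n + 1, x, e, z => ENNReal.ofReal (Real.exp (-δ * e 0)) *
      if z 0 * flow r cT xs B x (e 0) < xs then
        (w (flow r cT xs B x (e 0) - xs) (xs - z 0 * flow r cT xs B x (e 0)) : ℝ≥0∞)
      else truncatedPenalty r cT xs B δ w n (z 0 * flow r cT xs B x (e 0))
        (fun i => e (i + 1)) (fun i => z (i + 1))

/-- The discounted penalty as a function of the initial capital and the random inputs. -/
noncomputable def inputPenalty (r cT xs B δ : ℝ) (w : ℝ → ℝ → ℝ≥0)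
    (x : ℝ) (e z : ℕ → ℝ) : ℝ≥0∞ := ⨆ n, truncatedPenalty r cT xs B δ w n x e z

lemma monotone_truncatedPenalty :
    Monotone fun n => truncatedPenalty r cT xs B δ w n x e z := by
  refine monotone_nat_of_le_succ fun n => ?_
  induction n generalizing x e z with
  | zero => exact bot_le
  | succ n ih =>
    rw [truncatedPenalty, truncatedPenalty]
    gcongr
    split_ifs
    · exact le_rfl
    · exact ih

/-- The recursion at the first loss, free of any trajectory. Dropping the zeroth term of the
monotone sequence does not change its supremum. -/
lemma inputPenalty_eq : inputPenalty r cT xs B δ w x e z =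
    ENNReal.ofReal (Real.exp (-δ * e 0)) *
      if z 0 * flow r cT xs B x (e 0) < xs then
        (w (flow r cT xs B x (e 0) - xs) (xs - z 0 * flow r cT xs B x (e 0)) : ℝ≥0∞)
      else inputPenalty r cT xs B δ w (z 0 * flow r cT xs B x (e 0))
        (fun i => e (i + 1)) (fun i => z (i + 1)) := by
  rw [inputPenalty, ← monotone_truncatedPenalty.iSup_nat_add 1]
  simp only [truncatedPenalty]
  rw [← ENNReal.mul_iSup]
  split_ifs <;> simp [inputPenalty]

lemma measurable_truncatedPenalty (hw : Measurable (fun p : ℝ × ℝ => w p.1 p.2)) (n : ℕ) :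
    Measurable (fun p : ℝ × (ℕ → ℝ) × (ℕ → ℝ) =>
      truncatedPenalty r cT xs B δ w n p.1 p.2.1 p.2.2) := by
  induction n with
  | zero => simp only [truncatedPenalty]; fun_prop
  | succ n ih =>
    have hφ : Measurable (fun p : ℝ × (ℕ → ℝ) × (ℕ → ℝ) => flow r cT xs B p.1 (p.2.1 0)) :=
      measurable_flow.comp (by fun_prop : Measurable fun p : ℝ × (ℕ → ℝ) × (ℕ → ℝ) =>
        (p.1, p.2.1 0))
    have hy : Measurable (fun p : ℝ × (ℕ → ℝ) × (ℕ → ℝ) =>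
        p.2.2 0 * flow r cT xs B p.1 (p.2.1 0)) := by fun_prop
    simp only [truncatedPenalty]
    refine Measurable.mul (by fun_prop) (Measurable.ite (measurableSet_lt hy measurable_const)
      ?_ ?_)
    · exact (hw.comp ((hφ.sub_const xs).prodMk (measurable_const.sub hy))).coe_nnreal_ennreal
    · exact ih.comp (hy.prodMk (by fun_prop :
        Measurable fun p : ℝ × (ℕ → ℝ) × (ℕ → ℝ) =>
          ((fun i => p.2.1 (i + 1), fun i => p.2.2 (i + 1)) : (ℕ → ℝ) × (ℕ → ℝ))))

/-- A countable supremum of finite recursions: no measurability of the trapping time, an infimum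
over uncountably many times, is needed. -/
lemma measurable_inputPenalty (hw : Measurable (fun p : ℝ × ℝ => w p.1 p.2)) :
    Measurable (fun p : ℝ × (ℕ → ℝ) × (ℕ → ℝ) =>
      inputPenalty r cT xs B δ w p.1 p.2.1 p.2.2) :=
  Measurable.iSup fun n => measurable_truncatedPenalty hw n

lemma IsCapitalPath.le_of_lt_wait (hf : IsCapitalPath r cT xs B x e z f) (hr : 0 < r)
    (hcT : 0 < cT) (hrc : r ≠ cT) (hB : xs < B) (hx : xs ≤ x) :
    ∀ t ∈ Ico 0 (e 0), xs ≤ f t := fun t ht => by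
  rw [hf.eq_flow hr hcT hrc hB hx ht]
  exact le_flow hr hcT hrc hB hx ht.1

lemma IsCapitalPath.discountedPenalty_eq (hf : IsCapitalPath r cT xs B x e z f) (hr : 0 < r)
    (hcT : 0 < cT) (hrc : r ≠ cT) (hB : xs < B) (hx : xs ≤ x) (he : 0 < e 0) :
    discountedPenalty xs δ w f = ENNReal.ofReal (Real.exp (-δ * e 0)) *
      if z 0 * flow r cT xs B x (e 0) < xs then
        (w (flow r cT xs B x (e 0) - xs) (xs - z 0 * flow r cT xs B x (e 0)) : ℝ≥0∞)
      else discountedPenalty xs δ w (fun t => f (t + e 0)) := by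
  rw [discountedPenalty_shift he.le (hf.le_of_lt_wait hr hcT hrc hB hx)]
  split_ifs with h
  · rw [← hf.apply_wait hr hcT hrc hB hx he] at h
    rw [discountedPenalty_of_lt (by simpa using h), leftLim_comp_add, zero_add,
      hf.leftLim_eq hr hcT hrc hB hx he, hf.apply_wait hr hcT hrc hB hx he]
  · rfl

/-- Growth keeps the capital at or above `x*`, so trapping happens only at losses and can be read
off from the capital at the loss times. The induction removes the first loss by
`IsCapitalPath.shift`. -/
lemma IsCapitalPath.truncatedPenalty_eq (hr : 0 < r) (hcT : 0 < cT) (hrc : r ≠ cT) (hB : xs < B)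
    (he : ∀ i, 0 < e i) (n : ℕ) (hx : xs ≤ x) (hf : IsCapitalPath r cT xs B x e z f) :
    truncatedPenalty r cT xs B δ w n x e z =
      if ∀ k ≤ n, xs ≤ f (lossTime e k) then 0 else discountedPenalty xs δ w f := by
  induction n generalizing x e z f with
  | zero =>
    have : xs ≤ f 0 := by rwa [hf.initial]
    simp [truncatedPenalty, this]
  | succ n ih =>
    have hwait := hf.apply_wait hr hcT hrc hB hx (he 0)
    have hall : (∀ k ≤ n + 1, xs ≤ f (lossTime e k)) ↔
        ∀ k ≤ n, xs ≤ f (lossTime (fun i => e (i + 1)) k + e 0) := by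
      constructor
      · intro h k hk
        have := h (k + 1) (by omega)
        rwa [lossTime_succ'] at this
      · rintro h (_ | k) hk
        · simpa [hf.initial] using hx
        · rw [lossTime_succ']
          exact h k (by omega)
    rw [truncatedPenalty, hf.discountedPenalty_eq hr hcT hrc hB hx (he 0)]
    by_cases h : z 0 * flow r cT xs B x (e 0) < xs
    · have hne : ¬ ∀ k ≤ n + 1, xs ≤ f (lossTime e k) := fun hk => by
        have := hk 1 (by omega)
        rw [lossTime_one, hwait] at this
        exact absurd h (not_lt.2 this)
      rw [if_pos h, if_neg hne, if_pos h]
    · have hs := hf.shift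
      rw [hwait] at hs
      rw [if_neg h, ih (fun i => he (i + 1)) (not_lt.1 h) hs]
      by_cases hk : ∀ k ≤ n + 1, xs ≤ f (lossTime e k)
      · rw [if_pos hk, if_pos (hall.1 hk), mul_zero]
      · rw [if_neg hk, if_neg (fun h' => hk (hall.2 h')), if_neg h]

/-- If the capital is at least `x*` at all loss times, it is so at all times
before any given loss. -/
lemma IsCapitalPath.le_of_forall_lossTime (hr : 0 < r) (hcT : 0 < cT) (hrc : r ≠ cT) (hB : xs < B)
    (he : ∀ i, 0 < e i) (n : ℕ) (hf : IsCapitalPath r cT xs B x e z f)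
    (h : ∀ k, xs ≤ f (lossTime e k)) {t : ℝ} (h0 : 0 ≤ t) (ht : t < lossTime e n) :
    xs ≤ f t := by
  induction n generalizing x e z f t with
  | zero => simp at ht; linarith
  | succ n ih =>
    have hx : xs ≤ x := by simpa [hf.initial] using h 0
    rcases lt_or_ge t (e 0) with h1 | h1
    · exact hf.le_of_lt_wait hr hcT hrc hB hx t ⟨h0, h1⟩
    · have := ih (fun i => he (i + 1)) hf.shift
        (fun k => by simpa only [lossTime_succ'] using h (k + 1)) (t := t - e 0) (by linarith)
        (by rw [lossTime_succ'] at ht; linarith)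
      simpa using this

/-- If some loss leaves the capital below `x*`, the truncation at that loss already equals the full
penalty. Otherwise `hT` places every time before some loss, so the path is never trapped and both
sides vanish. -/
lemma IsCapitalPath.discountedPenalty_eq_inputPenalty (hf : IsCapitalPath r cT xs B x e z f)
    (hr : 0 < r) (hcT : 0 < cT) (hrc : r ≠ cT) (hB : xs < B) (hx : xs ≤ x)
    (he : ∀ i, 0 < e i) (hT : Tendsto (lossTime e) atTop atTop) :
    discountedPenalty xs δ w f = inputPenalty r cT xs B δ w x e z := by
  have key := fun n => hf.truncatedPenalty_eq (δ := δ) (w := w) hr hcT hrc hB he n hx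
  by_cases h : ∀ k, xs ≤ f (lossTime e k)
  · have h1 : ∀ t, 0 ≤ t → xs ≤ f t := fun t h0 => by
      obtain ⟨n, hn⟩ := (hT.eventually_gt_atTop t).exists
      exact hf.le_of_forall_lossTime hr hcT hrc hB he n h h0 hn
    have h2 : {t : ℝ | 0 ≤ t ∧ f t < xs} = ∅ :=
      eq_empty_of_forall_notMem fun t ht => absurd ht.2 (not_lt.2 (h1 t ht.1))
    have h3 : inputPenalty r cT xs B δ w x e z = 0 := by
      refine ENNReal.iSup_eq_zero.2 fun n => ?_
      rw [key n, if_pos fun k _ => h k]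
    rw [h3, discountedPenalty, trappingTime, h2]
    simp
  · push Not at h
    obtain ⟨k, hk⟩ := h
    refine le_antisymm ?_ (iSup_le fun n => ?_)
    · refine le_trans (le_of_eq ?_) (le_iSup _ k)
      rw [key k, if_neg fun h' => absurd hk (not_lt.2 (h' k le_rfl))]
    · rw [key n]
      split_ifs <;> simp

end Paths

/-! ### The law of the inputs and the renewal equation -/

section Probability

lemma ae_pos_expMeasure {lam : ℝ} (hlam : 0 < lam) : ∀ᵐ t ∂expMeasure lam, 0 < t := by
  have := isProbabilityMeasure_expMeasure hlam
  have h : expMeasure lam (Iic 0) = 0 := by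
    rw [← ofReal_cdf, cdf_expMeasure_eq hlam]
    simp
  refine measure_mono_null (fun t ht => ?_) h
  simpa using ht

lemma expMeasure_Ioi_one_ne_zero {lam : ℝ} (hlam : 0 < lam) : expMeasure lam (Ioi 1) ≠ 0 := by
  have := isProbabilityMeasure_expMeasure hlam
  rw [← compl_Iic, prob_compl_eq_one_sub measurableSet_Iic, ← ofReal_cdf, cdf_expMeasure_eq hlam,
    if_pos zero_le_one]
  refine (tsub_pos_of_lt ?_).ne'
  rw [ENNReal.ofReal_lt_one]
  linarith [Real.exp_pos (-(lam * 1))]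

lemma lintegral_expMeasure {lam : ℝ} {g : ℝ → ℝ≥0∞} (hg : Measurable g) :
    ∫⁻ t, g t ∂expMeasure lam =
      ∫⁻ t in Ioi 0, ENNReal.ofReal (lam * Real.exp (-(lam * t))) * g t := by
  have hm : Measurable (exponentialPDF lam) :=
    (measurable_exponentialPDFReal lam).ennreal_ofReal
  have hE : expMeasure lam = volume.withDensity (exponentialPDF lam) := rfl
  rw [hE, lintegral_withDensity_eq_lintegral_mul _ hm hg, setLIntegral_congr Ioi_ae_eq_Ici,
    ← lintegral_indicator measurableSet_Ici]
  refine lintegral_congr fun t => ?_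
  by_cases ht : 0 ≤ t
  · simp [ht, exponentialPDF_eq]
  · simp [ht, exponentialPDF_eq]

/-- The distribution of an i.i.d. sequence is that of an independent first term followed by a copy
of the sequence. -/
lemma map_cons_prod_infinitePi (ν : Measure ℝ) [IsProbabilityMeasure ν] :
    (ν.prod (Measure.infinitePi fun _ : ℕ => ν)).map
      (fun p n => Nat.casesOn (motive := fun _ => ℝ) n p.1 p.2) =
      Measure.infinitePi fun _ : ℕ => ν := by
  classical
  have hm : Measurable fun (p : ℝ × (ℕ → ℝ)) (n : ℕ) =>
      Nat.casesOn (motive := fun _ => ℝ) n p.1 p.2 := by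
    refine measurable_pi_lambda _ fun n => ?_
    cases n <;> dsimp only <;> fun_prop
  refine Measure.eq_infinitePi _ fun s t ht => ?_
  obtain ⟨N, hN⟩ : ∃ N, s ⊆ Finset.range (N + 1) :=
    ⟨s.sup id, fun i hi => Finset.mem_range.2 (Nat.lt_succ_of_le (Finset.le_sup (f := id) hi))⟩
  -- Padding with `univ` turns the cylinder over `s` into one over an initial segment, from which
  -- coordinate `0` splits off.
  set t' : ℕ → Set ℝ := fun i => if i ∈ s then t i else univ with ht'
  have hmt' : ∀ i, MeasurableSet (t' i) := fun i => by
    simp only [ht']; split_ifs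
    · exact ht i
    · exact MeasurableSet.univ
  have hprod : ∏ i ∈ s, ν (t i) = ∏ i ∈ Finset.range (N + 1), ν (t' i) := by
    rw [← Finset.prod_subset hN (f := fun i => ν (t' i))]
    · exact Finset.prod_congr rfl fun i hi => by simp [ht', hi]
    · intro i _ hi
      simp [ht', hi]
  have hpre : (fun (p : ℝ × (ℕ → ℝ)) (n : ℕ) => Nat.casesOn (motive := fun _ => ℝ) n p.1 p.2) ⁻¹'
      (Set.pi s t) = t' 0 ×ˢ Set.pi (Finset.range N) (fun i => t' (i + 1)) := by
    ext p
    simp only [mem_preimage, Set.mem_pi, mem_prod, Finset.mem_coe, Finset.mem_range]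
    constructor
    · intro h
      refine ⟨?_, fun i _ => ?_⟩
      · by_cases h0 : 0 ∈ s
        · simpa [ht', h0] using h 0 h0
        · simp [ht', h0]
      · by_cases h0 : i + 1 ∈ s
        · simpa [ht', h0] using h (i + 1) h0
        · simp [ht', h0]
    · rintro ⟨h0, h1⟩ (_ | i) hi
      · simpa [ht', hi] using h0
      · have := h1 i (by have := Finset.mem_range.1 (hN hi); omega)
        simpa [ht', hi] using this
  rw [Measure.map_apply hm (MeasurableSet.pi s.countable_toSet fun i _ => ht i), hpre,
    Measure.prod_prod, Measure.infinitePi_pi _ fun i _ => hmt' (i + 1), hprod,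
    Finset.prod_range_succ', mul_comm]

section Model

variable {Ω : Type*} [MeasurableSpace Ω] {P : Measure Ω} {lam : ℝ} {G : Measure ℝ}
  {E Z : ℕ → Ω → ℝ}

lemma IsLossModel.ae_wait_pos (h : IsLossModel P lam G E Z) (hlam : 0 < lam) :
    ∀ᵐ ω ∂P, ∀ n, 0 < E n ω := by
  refine ae_all_iff.2 fun n => ?_
  have := ae_pos_expMeasure hlam
  rw [← h.law_wait n] at this
  exact ae_of_ae_map (h.measurable_wait n).aemeasurable this

/-- The Poisson process does not explode. -/
lemma IsLossModel.ae_tendsto_lossTime [IsProbabilityMeasure P] (h : IsLossModel P lam G E Z)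
    (hlam : 0 < lam) : ∀ᵐ ω ∂P, Tendsto (lossTime fun n => E n ω) atTop atTop := by
  -- By the second Borel–Cantelli lemma infinitely many waiting times exceed `1`, so their terms do
  -- not tend to `0` and their sum diverges.
  have hms : ∀ n, MeasurableSet (E n ⁻¹' Ioi 1) := fun n => h.measurable_wait n measurableSet_Ioi
  have hind : iIndepSet (fun n => E n ⁻¹' Ioi 1) P := by
    rw [iIndepSet_iff_meas_biInter hms]
    exact fun s => h.indep_wait.measure_inter_preimage_eq_mul s fun _ _ => measurableSet_Ioi
  have hsum : ∑' n, P (E n ⁻¹' Ioi 1) = ∞ := by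
    have : ∀ n, P (E n ⁻¹' Ioi 1) = expMeasure lam (Ioi 1) := fun n => by
      rw [← h.law_wait n, Measure.map_apply (h.measurable_wait n) measurableSet_Ioi]
    simp only [this]
    exact ENNReal.tsum_const_eq_top_of_ne_zero (expMeasure_Ioi_one_ne_zero hlam)
  have hls := measure_limsup_eq_one hms hind hsum
  have hmls : MeasurableSet (limsup (fun n => E n ⁻¹' Ioi 1) atTop) :=
    MeasurableSet.measurableSet_limsup hms
  filter_upwards [h.ae_wait_pos hlam, (mem_ae_iff_prob_eq_one hmls).2 hls] with ω hpos hω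
  rw [limsup_eq_iInf_iSup_of_nat] at hω
  have hfreq : ∃ᶠ n in atTop, 1 < E n ω := by
    refine frequently_atTop.2 fun a => ?_
    simp only [iInf_eq_iInter, iSup_eq_iUnion, mem_iInter, mem_iUnion] at hω
    obtain ⟨n, hn, h1⟩ := hω a
    exact ⟨n, hn, h1⟩
  refine (not_summable_iff_tendsto_nat_atTop_of_nonneg fun n => (hpos n).le).1 fun hs => ?_
  have := hs.tendsto_atTop_zero.eventually_lt_const one_pos
  obtain ⟨n, h1, h2⟩ := (hfreq.and_eventually this).exists
  linarith

/-- With the joint law known, the expectation becomes an integral over pairs of sequences, where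
first terms can be split off. -/
lemma IsLossModel.map_eq [IsProbabilityMeasure P] [IsProbabilityMeasure G]
    (h : IsLossModel P lam G E Z)    (hlam : 0 < lam) :
    P.map (fun ω => ((fun n => E n ω, fun n => Z n ω) : (ℕ → ℝ) × (ℕ → ℝ))) =
      (Measure.infinitePi fun _ : ℕ => expMeasure lam).prod
        (Measure.infinitePi fun _ : ℕ => G) := by
  have := isProbabilityMeasure_expMeasure hlam
  have hE := h.measurable_wait
  have hZ := h.measurable_prop
  rw [h.indep.map_prod_eq_prod_map_map (by fun_prop) (by fun_prop),
    h.indep_wait.map_fun_eq_infinitePi_map hE, h.indep_prop.map_fun_eq_infinitePi_map hZ]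
  congr 2 <;> funext n
  · exact h.law_wait n
  · exact h.law_prop n

end Model

/-- The expected discounted penalty in terms of the law of the random inputs. -/
noncomputable def meanPenalty (r cT xs B lam δ : ℝ) (w : ℝ → ℝ → ℝ≥0) (G : Measure ℝ)
    (x : ℝ) : ℝ≥0∞ :=
  ∫⁻ p, inputPenalty r cT xs B δ w x p.1 p.2 ∂(Measure.infinitePi fun _ : ℕ => expMeasure lam).prod
    (Measure.infinitePi fun _ : ℕ => G)

/-- The expected value after a loss at capital level `u`, for the value function `M`. -/
noncomputable def lossValue (xs : ℝ) (w : ℝ → ℝ → ℝ≥0) (G : Measure ℝ) (M : ℝ → ℝ≥0∞)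
    (u : ℝ) : ℝ≥0∞ :=
  ∫⁻ z, (if z * u < xs then (w (u - xs) (xs - z * u) : ℝ≥0∞) else M (z * u)) ∂G

variable {r cT xs B lam δ : ℝ} {w : ℝ → ℝ → ℝ≥0} {G : Measure ℝ} [IsProbabilityMeasure G]

lemma measurable_meanPenalty (hw : Measurable (fun p : ℝ × ℝ => w p.1 p.2)) (hlam : 0 < lam) :
    Measurable (meanPenalty r cT xs B lam δ w G) := by
  have := isProbabilityMeasure_expMeasure hlam
  exact (measurable_inputPenalty hw).lintegral_prod_right'

lemma measurable_lossIntegrand (hw : Measurable (fun p : ℝ × ℝ => w p.1 p.2)) {M : ℝ → ℝ≥0∞}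
    (hM : Measurable M) : Measurable (fun p : ℝ × ℝ =>
      if p.2 * p.1 < xs then (w (p.1 - xs) (xs - p.2 * p.1) : ℝ≥0∞) else M (p.2 * p.1)) := by
  refine Measurable.ite (measurableSet_lt (by fun_prop) measurable_const) ?_ (by fun_prop)
  exact (hw.comp (by fun_prop : Measurable fun p : ℝ × ℝ =>
    (p.1 - xs, xs - p.2 * p.1))).coe_nnreal_ennreal

lemma measurable_lossValue (hw : Measurable (fun p : ℝ × ℝ => w p.1 p.2)) {M : ℝ → ℝ≥0∞}
    (hM : Measurable M) : Measurable (lossValue xs w G M) :=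
  (measurable_lossIntegrand hw hM).lintegral_prod_right'

/-- Conditioning on the first loss. -/
lemma meanPenalty_eq_lintegral_lossValue (hw : Measurable (fun p : ℝ × ℝ => w p.1 p.2))
    (hlam : 0 < lam) (x : ℝ) :
    meanPenalty r cT xs B lam δ w G x = ∫⁻ t, ENNReal.ofReal (Real.exp (-δ * t)) *
      lossValue xs w G (meanPenalty r cT xs B lam δ w G) (flow r cT xs B x t)
        ∂expMeasure lam := by
  have := isProbabilityMeasure_expMeasure hlam
  set μE := Measure.infinitePi fun _ : ℕ => expMeasure lam with hμE
  set μZ := Measure.infinitePi fun _ : ℕ => G with hμZ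
  set cons : ℝ × (ℕ → ℝ) → ℕ → ℝ := fun p n => Nat.casesOn (motive := fun _ => ℝ) n p.1 p.2
    with hcons
  have hmc : Measurable cons := by
    refine measurable_pi_lambda _ fun n => ?_
    cases n <;> simp only [hcons] <;> fun_prop
  have hI := measurable_inputPenalty (r := r) (cT := cT) (xs := xs) (B := B) (δ := δ) hw
  have hIx : Measurable fun p : (ℕ → ℝ) × (ℕ → ℝ) => inputPenalty r cT xs B δ w x p.1 p.2 :=
    hI.comp (measurable_const.prodMk measurable_id)
  have hF : Measurable fun q : (ℝ × (ℕ → ℝ)) × (ℝ × (ℕ → ℝ)) =>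
      inputPenalty r cT xs B δ w x (cons q.1) (cons q.2) :=
    hIx.comp (by fun_prop : Measurable fun q : (ℝ × (ℕ → ℝ)) × (ℝ × (ℕ → ℝ)) =>
      (cons q.1, cons q.2))
  have hlaw : μE.prod μZ =
      (((expMeasure lam).prod μE).prod (G.prod μZ)).map (Prod.map cons cons) := by
    rw [← Measure.map_prod_map _ _ hmc hmc, map_cons_prod_infinitePi, map_cons_prod_infinitePi]
  have hstep : ∀ t e' z z', inputPenalty r cT xs B δ w x (cons (t, e')) (cons (z, z')) =
      ENNReal.ofReal (Real.exp (-δ * t)) * if z * flow r cT xs B x t < xs then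
        (w (flow r cT xs B x t - xs) (xs - z * flow r cT xs B x t) : ℝ≥0∞)
      else inputPenalty r cT xs B δ w (z * flow r cT xs B x t) e' z' :=
    fun t e' z z' => inputPenalty_eq
  calc meanPenalty r cT xs B lam δ w G x
      = ∫⁻ q, inputPenalty r cT xs B δ w x (cons q.1) (cons q.2)
          ∂((expMeasure lam).prod μE).prod (G.prod μZ) := by
        rw [meanPenalty, ← hμE, ← hμZ, hlaw, lintegral_map hIx (hmc.prodMap hmc)]
        rfl
    _ = ∫⁻ t, ∫⁻ e', ∫⁻ z, ∫⁻ z', inputPenalty r cT xs B δ w x (cons (t, e')) (cons (z, z'))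
          ∂μZ ∂G ∂μE ∂expMeasure lam := by
        rw [lintegral_prod _ hF.aemeasurable, lintegral_prod _ hF.lintegral_prod_right'.aemeasurable]
        refine lintegral_congr fun t => lintegral_congr fun e' => ?_
        exact lintegral_prod _ (hF.comp measurable_prodMk_left).aemeasurable
    -- The first proportion moves outside the later waiting times, so that the two innermost
    -- integrals form `meanPenalty` at the capital after the loss.
    _ = ∫⁻ t, ∫⁻ z, ∫⁻ e', ∫⁻ z', inputPenalty r cT xs B δ w x (cons (t, e')) (cons (z, z'))
          ∂μZ ∂μE ∂G ∂expMeasure lam := by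
        refine lintegral_congr fun t => lintegral_lintegral_swap ?_
        have : Measurable fun q : ((ℕ → ℝ) × ℝ) × (ℕ → ℝ) =>
            inputPenalty r cT xs B δ w x (cons (t, q.1.1)) (cons (q.1.2, q.2)) :=
          hF.comp (by fun_prop : Measurable fun q : ((ℕ → ℝ) × ℝ) × (ℕ → ℝ) =>
            ((t, q.1.1), (q.1.2, q.2)))
        exact this.lintegral_prod_right'.aemeasurable
    _ = _ := by
        refine lintegral_congr fun t => ?_
        rw [lossValue, ← lintegral_const_mul' _ _ ENNReal.ofReal_ne_top]
        refine lintegral_congr fun z => ?_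
        simp only [hstep]
        split_ifs with h
        · simp
        · simp only [lintegral_const_mul' _ _ ENNReal.ofReal_ne_top]
          congr 1
          rw [meanPenalty, lintegral_prod]
          exact (hI.comp measurable_prodMk_left).aemeasurable

/-- The discount merges with the exponential density into the single rate `lam + δ`. -/
lemma meanPenalty_eq_setLIntegral (hw : Measurable (fun p : ℝ × ℝ => w p.1 p.2))
    (hlam : 0 < lam) (x : ℝ) :
    meanPenalty r cT xs B lam δ w G x =
      ∫⁻ t in Ioi 0, ENNReal.ofReal (lam * Real.exp (-(lam + δ) * t)) *
        lossValue xs w G (meanPenalty r cT xs B lam δ w G) (flow r cT xs B x t) := by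
  have hM := measurable_meanPenalty (r := r) (cT := cT) (xs := xs) (B := B) (δ := δ) (G := G)
    hw hlam
  have hflow : Measurable fun t => flow r cT xs B x t :=
    measurable_flow.comp measurable_prodMk_left
  have hK : Measurable fun t => lossValue xs w G (meanPenalty r cT xs B lam δ w G)
      (flow r cT xs B x t) := (measurable_lossValue hw hM).comp hflow
  rw [meanPenalty_eq_lintegral_lossValue hw hlam,
    lintegral_expMeasure (by fun_prop)]
  refine lintegral_congr fun t => ?_
  rw [← mul_assoc, ← ENNReal.ofReal_mul (by positivity), mul_assoc, ← Real.exp_add]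
  congr 4
  ring

/-- Almost sure equality for each fixed `x` suffices: the restart at a random level takes place in
`meanPenalty`, so no joint regularity of `X` in `x` is required. -/
lemma IsCapitalProcess.expectedPenalty_eq {Ω : Type*} [MeasurableSpace Ω] {P : Measure Ω}
    [IsProbabilityMeasure P] {E Z : ℕ → Ω → ℝ} {X : ℝ → ℝ → Ω → ℝ}
    (hX : IsCapitalProcess P r cT xs B E Z X) (hEZ : IsLossModel P lam G E Z)
    (hr : 0 < r) (hcT : 0 < cT) (hrc : r ≠ cT) (hB : xs < B) (hlam : 0 < lam)
    (hw : Measurable (fun p : ℝ × ℝ => w p.1 p.2)) {x : ℝ} (hx : xs ≤ x) :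
    expectedPenalty P xs δ w X x = meanPenalty r cT xs B lam δ w G x := by
  have hE := hEZ.measurable_wait
  have hZ := hEZ.measurable_prop
  have hI : Measurable fun p : (ℕ → ℝ) × (ℕ → ℝ) => inputPenalty r cT xs B δ w x p.1 p.2 :=
    (measurable_inputPenalty hw).comp measurable_prodMk_left
  rw [meanPenalty, ← hEZ.map_eq hlam, lintegral_map hI (by fun_prop)]
  refine lintegral_congr_ae ?_
  filter_upwards [hX x hx, hEZ.ae_wait_pos hlam, hEZ.ae_tendsto_lossTime hlam] with ω h1 h2 h3
  exact h1.discountedPenalty_eq_inputPenalty hr hcT hrc hB hx h2 h3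

end Probability

/-! ### From time integrals to integrals over capital levels -/

section ChangeOfVariables

variable {r cT xs B x lam δ : ℝ}

/-- For `v = a e^{st}` one has `e^{-qt} = (a / v)^{q/s}`, and the extra power of `v` in the
denominator cancels the Jacobian `|s| v`. It serves both regimes: `s = r`, `a = x - x*` above `B`,
and `s = r - cT`, `a = |x + x**|` below. -/
lemma abs_deriv_mul_density {s a q t : ℝ} (hs : s ≠ 0) (ha : 0 < a) :
    |s| * a * Real.exp (s * t) * (lam / |s| * a ^ (q / s) *
      (1 / (a * Real.exp (s * t)) ^ (q / s + 1))) = lam * Real.exp (-q * t) := by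
  have h1 : (a * Real.exp (s * t)) ^ (q / s + 1) =
      a ^ (q / s) * a * (Real.exp (q * t) * Real.exp (s * t)) := by
    rw [Real.mul_rpow ha.le (Real.exp_pos _).le, Real.rpow_add ha, Real.rpow_one, ← Real.exp_mul,
      ← Real.exp_add]
    congr 2
    field_simp
  have h2 : |s| ≠ 0 := abs_ne_zero.2 hs
  have h3 : a ^ (q / s) ≠ 0 := (Real.rpow_pos_of_pos ha _).ne'
  rw [h1, neg_mul, Real.exp_neg]
  field_simp

lemma image_upperFlow (hr : 0 < r) (hx : xs < x) : upperFlow r xs x '' Ioi 0 = Ioi x := by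
  ext u
  constructor
  · rintro ⟨t, ht, rfl⟩
    simpa using strictMono_upperFlow hr hx ht
  · intro hu
    have h0 : 0 < x - xs := sub_pos.2 hx
    have h1 : 1 < (u - xs) / (x - xs) := by
      rw [one_lt_div h0]; linarith [mem_Ioi.1 hu]
    refine ⟨Real.log ((u - xs) / (x - xs)) / r, div_pos (Real.log_pos h1) hr, ?_⟩
    rw [upperFlow, mul_div_cancel₀ _ hr.ne', Real.exp_log (by linarith), mul_div_cancel₀ _ h0.ne']
    ring

lemma image_lowerFlow (hr : 0 < r) (hcT : 0 < cT) (hrc : r ≠ cT) (hB : xs < B)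
    (hx : xs ≤ x) (hxB : x < B) :
    lowerFlow r cT xs B x '' Ioo 0 (hittingTime r cT xs B x) = Ioo x B := by
  have hm := strictMono_lowerFlow hr hcT hrc hB hx hxB.le
  have hh := lowerFlow_hittingTime hr hcT hrc hB hx hxB.le
  refine Subset.antisymm ?_ ?_
  · rintro _ ⟨t, ht, rfl⟩
    have h1 := hm ht.1
    have h2 := hm ht.2
    rw [lowerFlow_zero] at h1
    rw [hh] at h2
    exact ⟨h1, h2⟩
  · have := intermediate_value_Ioo (hittingTime_pos hr hcT hrc hB hx hxB).le
      (continuous_lowerFlow (r := r) (cT := cT) (xs := xs) (B := B) (x := x)).continuousOn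
    rwa [lowerFlow_zero, hh] at this

lemma lintegral_upperFlow (hr : 0 < r) (hlam : 0 < lam) (hx : xs < x) (q : ℝ)
    (K : ℝ → ℝ≥0∞) :
    ∫⁻ t in Ioi 0, ENNReal.ofReal (lam * Real.exp (-q * t)) * K (upperFlow r xs x t) =
      ENNReal.ofReal (lam / r * (x - xs) ^ (q / r)) *
        ∫⁻ u in Ioi x, ENNReal.ofReal (1 / (u - xs) ^ (q / r + 1)) * K u := by
  have h0 : 0 < x - xs := sub_pos.2 hx
  rw [← lintegral_const_mul' _ _ ENNReal.ofReal_ne_top, ← image_upperFlow hr hx,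
    lintegral_image_eq_lintegral_abs_deriv_mul measurableSet_Ioi
      (fun t _ => (hasDerivAt_upperFlow t).hasDerivWithinAt)
      (strictMono_upperFlow hr hx).injective.injOn]
  refine setLIntegral_congr_fun measurableSet_Ioi fun t _ => ?_
  have hu : upperFlow r xs x t - xs = (x - xs) * Real.exp (r * t) := by rw [upperFlow]; ring
  have key := abs_deriv_mul_density (lam := lam) (q := q) (t := t) hr.ne' h0
  rw [abs_of_pos hr] at key
  have hpos : 0 ≤ lam / r * (x - xs) ^ (q / r) := by positivity
  have hpos' : 0 ≤ r * (x - xs) * Real.exp (r * t) := by positivity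
  simp only [hu]
  rw [abs_of_nonneg hpos', ← mul_assoc (ENNReal.ofReal (lam / r * _)), ← mul_assoc,
    ← ENNReal.ofReal_mul hpos, ← ENNReal.ofReal_mul hpos', key]

lemma lintegral_lowerFlow (hr : 0 < r) (hcT : 0 < cT) (hrc : r ≠ cT) (hB : xs < B)
    (hlam : 0 < lam) (hx : xs ≤ x) (hxB : x < B) (q : ℝ) (K : ℝ → ℝ≥0∞) :
    ∫⁻ t in Ioo 0 (hittingTime r cT xs B x),
        ENNReal.ofReal (lam * Real.exp (-q * t)) * K (lowerFlow r cT xs B x t) =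
      ENNReal.ofReal (lam / |r - cT| * |x + xss r cT xs B| ^ (q / (r - cT))) *
        ∫⁻ u in Ioo x B,
          ENNReal.ofReal (1 / |u + xss r cT xs B| ^ (q / (r - cT) + 1)) * K u := by
  have h0 : 0 < |x + xss r cT xs B| := abs_pos.2 (add_xss_ne_zero hr hcT hrc hB hx hxB.le)
  rw [← lintegral_const_mul' _ _ ENNReal.ofReal_ne_top,
    ← image_lowerFlow hr hcT hrc hB hx hxB,
    lintegral_image_eq_lintegral_abs_deriv_mul measurableSet_Ioo
      (fun t _ => (hasDerivAt_lowerFlow t).hasDerivWithinAt)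
      (strictMono_lowerFlow hr hcT hrc hB hx hxB.le).injective.injOn]
  refine setLIntegral_congr_fun measurableSet_Ioo fun t _ => ?_
  have hu : |lowerFlow r cT xs B x t + xss r cT xs B| =
      |x + xss r cT xs B| * Real.exp ((r - cT) * t) := by
    rw [lowerFlow, sub_add_cancel, abs_mul, Real.abs_exp]
  have key := abs_deriv_mul_density (lam := lam) (q := q) (t := t) (sub_ne_zero.2 hrc) h0
  have hpos : 0 ≤ lam / |r - cT| * |x + xss r cT xs B| ^ (q / (r - cT)) := by positivity
  have hpos' : 0 ≤ |r - cT| * |x + xss r cT xs B| * Real.exp ((r - cT) * t) := by positivity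
  simp only [hu]
  rw [abs_mul, abs_mul, Real.abs_exp, ← mul_assoc (ENNReal.ofReal (lam / |r - cT| * _)),
    ← mul_assoc, ← ENNReal.ofReal_mul hpos, ← ENNReal.ofReal_mul hpos', key]

/-- For `q = λ + δ` this factor is the discounted probability of reaching `B` before the first loss.
-/
lemma rpow_add_xss_div (hr : 0 < r) (hcT : 0 < cT) (hrc : r ≠ cT) (hB : xs < B)
    (hx : xs ≤ x) (hxB : x ≤ B) (q : ℝ) :
    ((x + xss r cT xs B) / (B + xss r cT xs B)) ^ (q / (r - cT)) =
      Real.exp (-q * hittingTime r cT xs B x) := by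
  have h : r - cT ≠ 0 := sub_ne_zero.2 hrc
  rw [← inv_div, ← exp_mul_hittingTime hr hcT hrc hB hx hxB, ← Real.exp_neg, ← Real.exp_mul]
  congr 1
  field_simp

lemma lintegral_flow_of_le (hr : 0 < r) (hB : xs < B) (hlam : 0 < lam) (hx : B ≤ x) (q : ℝ)
    (K : ℝ → ℝ≥0∞) :
    ∫⁻ t in Ioi 0, ENNReal.ofReal (lam * Real.exp (-q * t)) * K (flow r cT xs B x t) =
      ENNReal.ofReal (lam / r * (x - xs) ^ (q / r)) *
        ∫⁻ u in Ioi x, ENNReal.ofReal (1 / (u - xs) ^ (q / r + 1)) * K u := by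
  rw [← lintegral_upperFlow hr hlam (hB.trans_le hx)]
  simp only [flow, if_pos hx]

/-- The time integral is cut when the flow reaches `B`. From then on the flow is the upper one
started at `B`, and translating time to that moment produces the factor of `rpow_add_xss_div`. -/
lemma lintegral_flow_of_lt (hr : 0 < r) (hcT : 0 < cT) (hrc : r ≠ cT) (hB : xs < B)
    (hlam : 0 < lam) (hx : xs ≤ x) (hxB : x < B) (q : ℝ) (K : ℝ → ℝ≥0∞) :
    ∫⁻ t in Ioi 0, ENNReal.ofReal (lam * Real.exp (-q * t)) * K (flow r cT xs B x t) =
      ENNReal.ofReal (lam / |r - cT| * |x + xss r cT xs B| ^ (q / (r - cT))) *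
        (∫⁻ u in Ioo x B,
          ENNReal.ofReal (1 / |u + xss r cT xs B| ^ (q / (r - cT) + 1)) * K u) +
      ENNReal.ofReal (lam / r * (B - xs) ^ (q / r) *
          ((x + xss r cT xs B) / (B + xss r cT xs B)) ^ (q / (r - cT))) *
        ∫⁻ v in Ioi B, ENNReal.ofReal (1 / (v - xs) ^ (q / r + 1)) * K v := by
  set h := hittingTime r cT xs B x with hh
  have hpos : 0 < h := hittingTime_pos hr hcT hrc hB hx hxB
  have hsplit : Ioi (0 : ℝ) = Ioo 0 h ∪ Ici h := (Ioo_union_Ici_eq_Ioi hpos).symm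
  have hdisj : Disjoint (Ioo 0 h) (Ici h) :=
    disjoint_left.2 fun t h1 h2 => absurd h1.2 (not_lt.2 h2)
  have himage : (fun t => t + h) '' Ici 0 = Ici h := by simp
  rw [hsplit, lintegral_union measurableSet_Ici hdisj,
    ← lintegral_lowerFlow hr hcT hrc hB hlam hx hxB]
  congr 1
  · refine setLIntegral_congr_fun measurableSet_Ioo fun t ht => ?_
    have : flow r cT xs B x t = lowerFlow r cT xs B x t := by
      rw [flow, if_neg (not_le.2 hxB), if_pos ht.2]
    simp only [this]
  · have hB' : 0 < B - xs := sub_pos.2 hB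
    rw [rpow_add_xss_div hr hcT hrc hB hx hxB.le, ENNReal.ofReal_mul (by positivity),
      mul_comm (ENNReal.ofReal (lam / r * _)), mul_assoc, ← lintegral_upperFlow hr hlam hB,
      ← lintegral_const_mul' _ _ ENNReal.ofReal_ne_top, ← himage,
      lintegral_image_eq_lintegral_abs_deriv_mul (f := fun t => t + h) (f' := fun _ => 1)
        measurableSet_Ici
        (fun t _ => ((hasDerivAt_id t).add_const h).hasDerivWithinAt)
        (fun a _ b _ hab => by simpa using hab), setLIntegral_congr Ioi_ae_eq_Ici]
    refine setLIntegral_congr_fun measurableSet_Ici fun t ht => ?_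
    have hflow : flow r cT xs B x (t + h) = upperFlow r xs B t := by
      rw [flow, if_neg (not_le.2 hxB), ← hh, if_neg (by simpa using ht),
        add_sub_cancel_right]
    simp only [hflow]
    rw [abs_one, ENNReal.ofReal_one, one_mul, ← mul_assoc, ← ENNReal.ofReal_mul (by positivity),
      ← hh, mul_add, Real.exp_add]
    congr 2
    ring

end ChangeOfVariables

/-! ### Splitting the value after a loss by the level reached -/

section LossValue

variable {xs B u : ℝ} {w : ℝ → ℝ → ℝ≥0} {G : Measure ℝ} {M : ℝ → ℝ≥0∞}

/-- The cut is at `z = x* / u`. A loss landing exactly on `x*` does not trap, so this endpoint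
belongs to the surviving part. -/
lemma lossValue_eq_add_trapPenalty (hG : ∀ᵐ z ∂G, z ∈ Icc (0 : ℝ) 1) (hxs : 0 < xs)
    (hu : xs ≤ u) : lossValue xs w G M u =
      (∫⁻ z in Icc (xs / u) 1, M (u * z) ∂G) + trapPenalty xs w G u := by
  have hu0 : 0 < u := hxs.trans_le hu
  have hsplit : Icc (0 : ℝ) 1 = Icc (xs / u) 1 ∪ Ico 0 (xs / u) := by
    rw [union_comm, Ico_union_Icc_eq_Icc (by positivity) ((div_le_one hu0).2 hu)]
  have hdisj : Disjoint (Icc (xs / u) 1) (Ico 0 (xs / u)) :=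
    disjoint_left.2 fun t h1 h2 => absurd h2.2 (not_lt.2 h1.1)
  have hrestr : lossValue xs w G M u = ∫⁻ z in Icc 0 1,
      (if z * u < xs then (w (u - xs) (xs - z * u) : ℝ≥0∞) else M (z * u)) ∂G := by
    rw [Measure.restrict_eq_self_of_ae_mem hG, lossValue]
  rw [hrestr, hsplit, lintegral_union measurableSet_Ico hdisj, trapPenalty]
  congr 1
  · refine setLIntegral_congr_fun measurableSet_Icc fun z hz => ?_
    have : ¬ z * u < xs := not_lt.2 ((div_le_iff₀ hu0).1 hz.1)
    simp only [if_neg this, mul_comm u z]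
  · refine setLIntegral_congr_fun measurableSet_Ico fun z hz => ?_
    simp only [if_pos ((lt_div_iff₀ hu0).1 hz.2), mul_comm u z]

/-- A loss cannot lift the capital back to `B`, so only the lower function is evaluated. -/
lemma lossValue_of_lt (hG : ∀ᵐ z ∂G, z ∈ Icc (0 : ℝ) 1) (hxs : 0 < xs) (hu : xs ≤ u)
    (huB : u < B) {ml : ℝ → ℝ≥0∞} (hml : ∀ x, xs ≤ x → x < B → ml x = M x) :
    lossValue xs w G M u =
      (∫⁻ z in Icc (xs / u) 1, ml (u * z) ∂G) + trapPenalty xs w G u := by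
  have hu0 : 0 < u := hxs.trans_le hu
  rw [lossValue_eq_add_trapPenalty hG hxs hu]
  congr 1
  refine setLIntegral_congr_fun measurableSet_Icc fun z hz => (hml _ ?_ ?_).symm
  · rw [mul_comm]; exact (div_le_iff₀ hu0).1 hz.1
  · exact (mul_le_of_le_one_right hu0.le hz.2).trans_lt huB

lemma lossValue_of_le (hG : ∀ᵐ z ∂G, z ∈ Icc (0 : ℝ) 1) (hxs : 0 < xs) (hB : xs < B)
    (hu : B ≤ u) {mu ml : ℝ → ℝ≥0∞} (hmu : ∀ x, B ≤ x → mu x = M x)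
    (hml : ∀ x, xs ≤ x → x < B → ml x = M x) :
    lossValue xs w G M u = (∫⁻ z in Icc (B / u) 1, mu (u * z) ∂G) +
      (∫⁻ z in Ico (xs / u) (B / u), ml (u * z) ∂G) + trapPenalty xs w G u := by
  have hu0 : 0 < u := (hxs.trans hB).trans_le hu
  have hsplit : Icc (xs / u) 1 = Icc (B / u) 1 ∪ Ico (xs / u) (B / u) := by
    rw [union_comm, Ico_union_Icc_eq_Icc (by gcongr) ((div_le_one hu0).2 hu)]
  have hdisj : Disjoint (Icc (B / u) 1) (Ico (xs / u) (B / u)) :=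
    disjoint_left.2 fun t h1 h2 => absurd h2.2 (not_lt.2 h1.1)
  rw [lossValue_eq_add_trapPenalty hG hxs (hB.le.trans hu), hsplit,
    lintegral_union measurableSet_Ico hdisj]
  congr 2
  · refine setLIntegral_congr_fun measurableSet_Icc fun z hz => (hmu _ ?_).symm
    rw [mul_comm]; exact (div_le_iff₀ hu0).1 hz.1
  · refine setLIntegral_congr_fun measurableSet_Ico fun z hz => (hml _ ?_ ?_).symm
    · rw [mul_comm]; exact (div_le_iff₀ hu0).1 hz.1
    · rw [mul_comm]; exact (lt_div_iff₀ hu0).1 hz.2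

end LossValue

end CapitalModel

theorem theorem3p1 {Ω : Type*} [MeasurableSpace Ω] (P : Measure Ω) [IsProbabilityMeasure P]
    (r cT xs B lam δ : ℝ) (hr : 0 < r) (hcT : 0 < cT) (hrc : r ≠ cT) (hxs : 0 < xs) (hB : xs < B)
    (hlam : 0 < lam) (hδ : 0 ≤ δ)
    (w : ℝ → ℝ → ℝ≥0) (hw : Measurable (fun p : ℝ × ℝ => w p.1 p.2))
    (G : Measure ℝ) [IsProbabilityMeasure G]
    (E Z : ℕ → Ω → ℝ) (hEZ : IsLossModel P lam G E Z)
    (X : ℝ → ℝ → Ω → ℝ) (hX : IsCapitalProcess P r cT xs B E Z X)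
    (mu ml : ℝ → ℝ≥0∞) (hmu : ∀ x, B ≤ x → mu x = expectedPenalty P xs δ w X x)
    (hml : ∀ x, xs ≤ x → x < B → ml x = expectedPenalty P xs δ w X x) :
    (∀ x, B ≤ x →
      mu x = ENNReal.ofReal (lam / r * (x - xs) ^ ((lam + δ) / r)) *
        ∫⁻ u in Ioi x, ENNReal.ofReal (1 / (u - xs) ^ ((lam + δ) / r + 1)) *
          ((∫⁻ z in Icc (B / u) 1, mu (u * z) ∂G) +
            (∫⁻ z in Ico (xs / u) (B / u), ml (u * z) ∂G) + trapPenalty xs w G u)) ∧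
    (∀ x, xs ≤ x → x < B →
      ml x =
        ENNReal.ofReal (lam / |r - cT| * |x + xss r cT xs B| ^ ((lam + δ) / (r - cT))) *
          (∫⁻ u in Ioo x B,
            ENNReal.ofReal (1 / |u + xss r cT xs B| ^ ((lam + δ) / (r - cT) + 1)) *
              ((∫⁻ z in Icc (xs / u) 1, ml (u * z) ∂G) + trapPenalty xs w G u)) +
        ENNReal.ofReal (lam / r * (B - xs) ^ ((lam + δ) / r) *
            ((x + xss r cT xs B) / (B + xss r cT xs B)) ^ ((lam + δ) / (r - cT))) *
          (∫⁻ v in Ioi B, ENNReal.ofReal (1 / (v - xs) ^ ((lam + δ) / r + 1)) *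
            ((∫⁻ z in Icc (B / v) 1, mu (v * z) ∂G) +
              (∫⁻ z in Ico (xs / v) (B / v), ml (v * z) ∂G) + trapPenalty xs w G v))) := by
  -- `mu` and `ml` are prescribed only on their own ranges; there both coincide with the one
  -- measurable function `meanPenalty`.
  have hM : ∀ x, xs ≤ x →
      expectedPenalty P xs δ w X x = meanPenalty r cT xs B lam δ w G x := fun x hx =>
    hX.expectedPenalty_eq hEZ hr hcT hrc hB hlam hw hx
  have hmu' : ∀ x, B ≤ x → mu x = meanPenalty r cT xs B lam δ w G x := fun x hx => by
    rw [hmu x hx, hM x (hB.le.trans hx)]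
  have hml' : ∀ x, xs ≤ x → x < B → ml x = meanPenalty r cT xs B lam δ w G x :=
    fun x hx hxB => by rw [hml x hx hxB, hM x hx]
  -- Needed twice: at the initial capital for the first identity, and at `B` for the second, where
  -- the flow continues above `B`.
  have hupper : ∀ x, B ≤ x → ∀ p : ℝ,
      ∫⁻ u in Ioi x, ENNReal.ofReal (1 / (u - xs) ^ p) *
        lossValue xs w G (meanPenalty r cT xs B lam δ w G) u =
      ∫⁻ u in Ioi x, ENNReal.ofReal (1 / (u - xs) ^ p) *
          ((∫⁻ z in Icc (B / u) 1, mu (u * z) ∂G) +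
            (∫⁻ z in Ico (xs / u) (B / u), ml (u * z) ∂G) + trapPenalty xs w G u) :=
    fun x hx p => setLIntegral_congr_fun measurableSet_Ioi fun u hu => by
      simp only [lossValue_of_le hEZ.prop_mem hxs hB (hx.trans (mem_Ioi.1 hu).le) hmu' hml']
  refine ⟨fun x hx => ?_, fun x hx hxB => ?_⟩
  · rw [hmu' x hx, meanPenalty_eq_setLIntegral hw hlam, lintegral_flow_of_le hr hB hlam hx,
      hupper x hx]
  · rw [hml' x hx hxB, meanPenalty_eq_setLIntegral hw hlam,
      lintegral_flow_of_lt hr hcT hrc hB hlam hx hxB, hupper B le_rfl]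
    congr 2
    refine setLIntegral_congr_fun measurableSet_Ioo fun u hu => ?_
    simp only [lossValue_of_lt hEZ.prop_mem hxs (hx.trans hu.1.le) hu.2 hml']
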